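/- \textbf{Theorem 2 (convergence of the two-loop algorithm for the max-min fair problem).} A base station with $M\ge 1$ antennas serves $G\ge1$ multicast groups; every user belongs to exactly one group, there are finitely many users and at least one, and user $i$ of group $g$ is denoted by $ig$. User $ig$ has channel estimate $\hat{\mathbf h}_{ig}\in\mathbb C^M$, noise level $\sigma_{ig}>0$ and error set $\mathcal S_{ig}=\{\mathbf e\in\mathbb C^M:\mathbf e^H\mathbf C_{ig}\mathbf e\le 1\}$ with $\mathbf C_{ig}$ Hermitian positive definite. For $\mathbf w=(\mathbf w_g)_{g}\in(\mathbb C^M)^G$ let $$\mathrm{SINR}_{ig}(\mathbf w,\mathbf e)=\frac{|\mathbf w_g^H(\hat{\mathbf h}_{ig}+\mathbf e)|^2}{\sum_{l\ne g}|\mathbf w_l^H(\hat{\mathbf h}_{ig}+\mathbf e)|^2+\sigma_{ig}^2},\qquad \varepsilon_{ig}=\frac1{\sqrt{\lambda_{\min}(\mathbf C_{ig})}},$$ $$\zeta_{ig}(\mathbf w,t)=\varepsilon_{ig}\|\mathbf w_g\|_2+\sqrt t\,\sqrt{\textstyle\sum_{l\ne g}\big(|\mathbf w_l^H\hat{\mathbf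 h}_{ig}|+\varepsilon_{ig}\|\mathbf w_l\|_2\big)^2+\sigma_{ig}^2}.$$ Let $\gamma>0$ and let $\mathcal W$ be the set of all $\mathbf w$ obeying the sum power constraint $\sum_g\|\mathbf w_g\|_2^2\le\gamma$ or, alternatively, the per-antenna constraints $\sum_g|(\mathbf w_g)_m|^2\le\gamma$, $m=1,\dots,M$. The robust max-min SINR problem is $$\mathcal P_{\text{MMF}}:\ \max_{\mathbf w\in\mathcal W}\ \min_{i,g}\ \min_{\mathbf e\in\mathcal S_{ig}}\mathrm{SINR}_{ig}(\mathbf w,\mathbf e),$$ and its approximation is $$\mathcal P_{\text{App-MMF}}:\ \max_{t\ge0,\ \mathbf w\in\mathcal W} t\quad\text{s.t. } \zeta_{ig}(\mathbf w,t)-|\mathbf w_g^H\hat{\mathbf h}_{ig}|\le0\ \text{ for all } i,g.$$ A feasible point $x$ of a problem $\max_{x\in X}f(x)$ is called \emph{stationary} if in every tangent direction of $X$ at $x$ (every limit of $y_n$ with $\tau_n\downarrow0$ and $x+\tau_ny_n\in X$) the upper directional derivative $\limsup_n (f(x+\tau_ny_n)-f(x))/\tau_n$ is $\le0$. \emph{Algorithm.}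 Start with any $\mathbf w^{(0)}$ such that $(\mathbf w^{(0)},t_0)$ is feasible for $\mathcal P_{\text{App-MMF}}$ for some $t_0$. In outer (majorization-minimization) iteration $k=0,1,\dots$ the surrogate problem at $\mathbf w^{(k)}$, $$\max_{t\ge0,\ \mathbf w\in\mathcal W} t\quad\text{s.t. }\ \zeta_{ig}(\mathbf w,t)-\frac{\operatorname{Re}\big((\mathbf w_g^{(k)})^H\hat{\mathbf h}_{ig}\hat{\mathbf h}_{ig}^H\mathbf w_g\big)}{|(\mathbf w_g^{(k)})^H\hat{\mathbf h}_{ig}|}\le0\ \text{ for all } i,g$$ (the quotient being read as $0$ if its denominator vanishes), is solved, either exactly or by bisection with a threshold $\xi_k>0$: from a bracket $0\le t_L<t_U$ containing its optimal value, with $\mathbf w^{(k)}$ feasible for it at level $t_L$, and with current vector $\mathbf w=\mathbf w^{(k)}$, repeat: put $t=(t_L+t_U)/2$; if the feasibility problem at level $t$ (find $\mathbf w\in\mathcal W$ satisfying the surrogate constraints for this $t$) is feasible, let $\mathbf w$ be any solution and put $t_L:=t$, else keep $\mathbf w$ and put $t_U:=t$; until $t_U-t_L\le\xi_k$. In both cases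 the resulting $(\mathbf w,t)$ is $(\mathbf w^{(k+1)},t^{(k+1)})$. \emph{Claim.} From every feasible initial point and for all thresholds $\xi_k>0$ the algorithm can be run, with every surrogate solved by bisection. Suppose moreover that $\sum_k\xi_k<\infty$. Then for every sequence $(\mathbf w^{(k)},t^{(k)})$ produced by the algorithm: (a) all feasibility problems (at every level $t\ge 0$) are convex, every surrogate problem has an optimal solution, and $t^{(k+1)}$ differs from its optimal value by at most $\xi_k$; (b) the algorithm converges to a stationary point of $\mathcal P_{\text{App-MMF}}$, in the sense usual for majorization-minimization methods: $t^{(k)}$ converges to some $t^\star$; the sequence $\mathbf w^{(k)}$ has a limit point; for each of its limit points $\mathbf w^\star$, $(\mathbf w^\star,t^\star)$ is a stationary point of $\mathcal P_{\text{App-MMF}}$; and the distance of $(\mathbf w^{(k)},t^{(k)})$ to the set of stationary points of $\mathcal P_{\text{App-MMF}}$ tends to $0$; (c) if $G=1$ and $\mathbf C_{i1}=\frac1{\mu^2}\mathbf I_M$ for all $i$, with some $\mu>0$, then each such $\mathbf w^\star$ is also a stationary point of $\mathcal P_{\text{MMF}}$, and its objective value there is $t^\star$. -/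

import Mathlib

open Filter Topology
open scoped ComplexOrder

/-- Data of the multicast system: a base station with `M` antennas serves `G` multicast groups.
`ι` is the set of all users; every user belongs to exactly one group. -/
structure MulticastSystem (M G : ℕ) (ι : Type*) where
  /-- the group of a user -/
  grp : ι → Fin G
  /-- the channel estimate of a user -/
  h : ι → EuclideanSpace ℂ (Fin M)
  /-- the matrix describing the error ellipsoid of a user -/
  C : ι → Matrix (Fin M) (Fin M) ℂ
  C_posDef : ∀ i, (C i).PosDef
  /-- the noise standard deviation of a user -/
  σ : ι → ℝ
  σ_pos : ∀ i, 0 < σ i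
  /-- the power limit -/
  γ : ℝ
  γ_pos : 0 < γ

/-- A family of beamforming vectors, one for each group. -/
abbrev Beamformer (M G : ℕ) : Type := Fin G → EuclideanSpace ℂ (Fin M)

/-- The two kinds of power constraints: total (sum) power, or power of each antenna. -/
inductive PowerKind
  | sumPower
  | perAntenna

/-- A (Bouligand) stationary point of the problem `max f(x)` subject to `x ∈ X`: a feasible point
such that in every tangent direction `d` of `X` at `x` (limits `d` of `y n` with
`x + τ n • y n ∈ X` and `τ n ↓ 0`) the upper directional derivative of `f` is nonpositive. -/
def IsStationaryPoint {E : Type*} [AddCommGroup E] [Module ℝ E] [TopologicalSpace E]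
    (X : Set E) (f : E → ℝ) (x : E) : Prop :=
  x ∈ X ∧ ∀ (d : E) (τ : ℕ → ℝ) (y : ℕ → E),
    (∀ n, 0 < τ n) → Tendsto τ atTop (𝓝 0) → Tendsto y atTop (𝓝 d) →
    (∀ n, x + τ n • y n ∈ X) →
    ∀ ε : ℝ, 0 < ε → ∀ᶠ n in atTop, (f (x + τ n • y n) - f x) / τ n ≤ ε

/-- State of the bisection loop: the bracket `[tL, tU]`, the value `t` tested last, and the
current beamformer `w`. -/
structure BisectionState (M G : ℕ) where
  tL : ℝ
  tU : ℝ
  t : ℝ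
  w : Beamformer M G

/-- One bisection step for the family of feasibility problems "find `w ∈ A t`": test the midpoint;
if the problem is feasible, some solution is stored and the lower end is raised, otherwise
the upper end is lowered. -/
def BisectionStep {M G : ℕ} (A : ℝ → Set (Beamformer M G)) (s s' : BisectionState M G) : Prop :=
  s'.t = (s.tL + s.tU) / 2 ∧
    ((s'.w ∈ A s'.t ∧ s'.tL = s'.t ∧ s'.tU = s.tU) ∨
     (A s'.t = ∅ ∧ s'.w = s.w ∧ s'.tL = s.tL ∧ s'.tU = s'.t))

namespace MulticastSystem

variable {M G : ℕ} {ι : Type*}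

/-- The error set `{e | eᴴ C e ≤ 1}` of a user. -/
def errorSet (S : MulticastSystem M G ι) (i : ι) : Set (EuclideanSpace ℂ (Fin M)) :=
  {e | (dotProduct (star e.ofLp) ((S.C i).mulVec e.ofLp)).re ≤ 1}

/-- The signal-to-interference-plus-noise ratio of user `i` for the channel error `e`. -/
noncomputable def SINR (S : MulticastSystem M G ι) (i : ι) (w : Beamformer M G)
    (e : EuclideanSpace ℂ (Fin M)) : ℝ :=
  ‖inner ℂ (w (S.grp i)) (S.h i + e)‖ ^ 2 /
    ((∑ l ∈ Finset.univ.erase (S.grp i), ‖inner ℂ (w l) (S.h i + e)‖ ^ 2) + S.σ i ^ 2)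

/-- The worst-case SINR over all users and all admissible channel errors:
the objective of the max-min fair problem. -/
noncomputable def worstSINR (S : MulticastSystem M G ι) (w : Beamformer M G) : ℝ :=
  ⨅ i : ι, ⨅ e : S.errorSet i, S.SINR i w e

/-- The beamformers obeying the power constraint(s): the feasible set of the max-min fair
problem. -/
def powerSet (S : MulticastSystem M G ι) : PowerKind → Set (Beamformer M G)
  | .sumPower => {w | ∑ g, ‖w g‖ ^ 2 ≤ S.γ}
  | .perAntenna => {w | ∀ m : Fin M, ∑ g, ‖w g m‖ ^ 2 ≤ S.γ}

/-- The smallest eigenvalue of the error matrix of a user. -/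
noncomputable def lambdaMin (S : MulticastSystem M G ι) (i : ι) : ℝ :=
  ⨅ m : Fin M, (S.C_posDef i).isHermitian.eigenvalues m

/-- `ε = 1 / √λ_min(C)`. -/
noncomputable def eps (S : MulticastSystem M G ι) (i : ι) : ℝ :=
  1 / √(S.lambdaMin i)

/-- The function `ζ(w, t)` of user `i`. -/
noncomputable def zeta (S : MulticastSystem M G ι) (i : ι) (w : Beamformer M G) (t : ℝ) : ℝ :=
  S.eps i * ‖w (S.grp i)‖ +
    √t * √((∑ l ∈ Finset.univ.erase (S.grp i),
      (‖inner ℂ (w l) (S.h i)‖ + S.eps i * ‖w l‖) ^ 2) + S.σ i ^ 2)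

/-- Feasible set of the approximate max-min fair problem, in the variables `(w, t)`, `t ≥ 0`.
The objective is the second coordinate. -/
def appFeasible (S : MulticastSystem M G ι) (P : PowerKind) : Set (Beamformer M G × ℝ) :=
  {p | 0 ≤ p.2 ∧ p.1 ∈ S.powerSet P ∧
    ∀ i, S.zeta i p.1 p.2 - ‖inner ℂ (p.1 (S.grp i)) (S.h i)‖ ≤ 0}

/-- The solutions of the feasibility problem at the current iterate `u` and level `t`. If
`u_gᴴ h = 0`, the quotient below is `0`, and the linear minorant of `|w_gᴴ h|` is the zero
function. -/
def feasibilitySet (S : MulticastSystem M G ι) (P : PowerKind) (u : Beamformer M G) (t : ℝ) :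
    Set (Beamformer M G) :=
  {w | w ∈ S.powerSet P ∧
    ∀ i, S.zeta i w t -
      (inner ℂ (u (S.grp i)) (S.h i) * inner ℂ (S.h i) (w (S.grp i))).re /
        ‖inner ℂ (u (S.grp i)) (S.h i)‖ ≤ 0}

/-- `(w, t)` is an optimal solution of the surrogate problem at the current iterate `u`. -/
def IsSurrogateSolution (S : MulticastSystem M G ι) (P : PowerKind) (u w : Beamformer M G)
    (t : ℝ) : Prop :=
  (0 ≤ t ∧ w ∈ S.feasibilitySet P u t) ∧
    ∀ (w' : Beamformer M G) (t' : ℝ), 0 ≤ t' → w' ∈ S.feasibilitySet P u t' → t' ≤ t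

/-- `(w, t)` is a possible output of the inner (repeat-until) loop started at the iterate `u`
with threshold `ξ`: the initial bracket `0 ≤ tL < tU` contains the optimal value of the surrogate
problem, `u` itself being feasible at level `tL`; bisection steps are made, at least one, until
for the first time `tU - tL ≤ ξ`. -/
def InnerLoopOutput (S : MulticastSystem M G ι) (P : PowerKind) (ξ : ℝ) (u w : Beamformer M G)
    (t : ℝ) : Prop :=
  ∃ (s : ℕ → BisectionState M G) (J : ℕ),
    (0 ≤ (s 0).tL ∧ (s 0).tL < (s 0).tU ∧ (s 0).w = u ∧ u ∈ S.feasibilitySet P u (s 0).tL ∧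
      ∀ t' : ℝ, 0 ≤ t' → (S.feasibilitySet P u t').Nonempty → t' ≤ (s 0).tU) ∧
    (∀ j < J, BisectionStep (S.feasibilitySet P u) (s j) (s (j + 1))) ∧
    1 ≤ J ∧ (s J).tU - (s J).tL ≤ ξ ∧ (∀ j, 1 ≤ j → j < J → ξ < (s j).tU - (s j).tL) ∧
    (s J).w = w ∧ (s J).t = t

/-- `(w k, t k)` is a sequence of iterates of the two-loop algorithm (without the outer stopping
test) started at a feasible point `w 0`. In outer iteration `k` the surrogate problem at `w k` is
solved, either exactly or by the bisection loop with threshold `ξ k`. -/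
def IsAlgorithmRun (S : MulticastSystem M G ι) (P : PowerKind) (ξ : ℕ → ℝ)
    (w : ℕ → Beamformer M G) (t : ℕ → ℝ) : Prop :=
  (∃ t₀ : ℝ, (w 0, t₀) ∈ S.appFeasible P) ∧
    ∀ k, S.IsSurrogateSolution P (w k) (w (k + 1)) (t (k + 1)) ∨
      S.InnerLoopOutput P (ξ k) (w k) (w (k + 1)) (t (k + 1))

end MulticastSystem

/-! Linearizing the gain `|w_gᴴ h|` at `u` gives a minorant that is exact at `u`. Surrogate-feasible
points are therefore feasible for the approximate problem, and each iterate, feasible at some level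
`a k`, is feasible at that level for its own surrogate. With surrogate optima `T k` this yields `a k
≤ T k` and `T k - ξ k ≤ a (k + 1)`; as levels are bounded and `ξ` is summable, `T`, `a` and `t`
share a limit `b` (`exists_levels`, `exists_tendsto_of_le_add_summable`). Limit points exist by
compactness of the power set.

Let `v` be a limit point and suppose that along a tangent sequence the level grows faster than `τ
ε`. If `b > 0`, no gain vanishes at `v`. The linearization error is `O(τ²)`, while halving the
growth of the level frees a margin of order `τ`, so the surrogate at `v` is feasible above level
`b`. Strict slack carries this over to the surrogates near `v`, contradicting `T → b`. If `b = 0`,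
some user has no margin at `v`, since otherwise the `T k` would stay away from `0`. For that user
`√(τ ε)` outgrows the `O(τ)` change of the gain. No constraint qualification is needed.

For one group and scalar error matrices, positive levels `t` are feasible at `w` in the power set
exactly when `t ≤ worstSINR w`, so stationarity passes from the hypograph to the function. -/

/-! ### Convexity inequalities. -/

theorem norm_combo_sq_le {E : Type*} [SeminormedAddCommGroup E] [NormedSpace ℝ E] (x y : E)
    {a b : ℝ} (ha : 0 ≤ a) (hb : 0 ≤ b) (hab : a + b = 1) :
    ‖a • x + b • y‖ ^ 2 ≤ a * ‖x‖ ^ 2 + b * ‖y‖ ^ 2 := by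
  have h := (convexOn_univ_norm (E := E)).pow (fun x _ => norm_nonneg x) 2
  simpa using h.2 (Set.mem_univ x) (Set.mem_univ y) ha hb hab

theorem norm_combo_le {E : Type*} [SeminormedAddCommGroup E] [NormedSpace ℝ E] (x y : E)
    {a b : ℝ} (ha : 0 ≤ a) (hb : 0 ≤ b) (hab : a + b = 1) :
    ‖a • x + b • y‖ ≤ a * ‖x‖ + b * ‖y‖ := by
  simpa using (convexOn_univ_norm (E := E)).2 (Set.mem_univ x) (Set.mem_univ y) ha hb hab

/-- Minkowski's inequality with an additional constant coordinate. -/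
theorem sqrt_sum_sq_add_const_combo_le {κ : Type*} (s : Finset κ) (f g k : κ → ℝ) (c : ℝ)
    {a b : ℝ} (ha : 0 ≤ a) (hb : 0 ≤ b) (hab : a + b = 1)
    (hf : ∀ l, 0 ≤ f l) (hg : ∀ l, 0 ≤ g l) (hk : ∀ l, 0 ≤ k l)
    (h : ∀ l, k l ≤ a * f l + b * g l) :
    √((∑ l ∈ s, k l ^ 2) + c ^ 2) ≤
      a * √((∑ l ∈ s, f l ^ 2) + c ^ 2) + b * √((∑ l ∈ s, g l ^ 2) + c ^ 2) := by
  have hA : 0 ≤ ∑ l ∈ s, f l ^ 2 := Finset.sum_nonneg fun _ _ => sq_nonneg _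
  have hB : 0 ≤ ∑ l ∈ s, g l ^ 2 := Finset.sum_nonneg fun _ _ => sq_nonneg _
  have hX : 0 ≤ ∑ l ∈ s, f l * g l := Finset.sum_nonneg fun l _ => mul_nonneg (hf l) (hg l)
  have hcs := Finset.sum_mul_sq_le_sq_mul_sq s f g
  have hsum : ∑ l ∈ s, k l ^ 2 ≤ a ^ 2 * ∑ l ∈ s, f l ^ 2 + b ^ 2 * ∑ l ∈ s, g l ^ 2 +
      2 * (a * b) * ∑ l ∈ s, f l * g l := by
    rw [Finset.mul_sum, Finset.mul_sum, Finset.mul_sum, ← Finset.sum_add_distrib,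
      ← Finset.sum_add_distrib]
    refine Finset.sum_le_sum fun l _ => ?_
    calc k l ^ 2 ≤ (a * f l + b * g l) ^ 2 := pow_le_pow_left₀ (hk l) (h l) 2
      _ = _ := by ring
  set A := ∑ l ∈ s, f l ^ 2
  set B := ∑ l ∈ s, g l ^ 2
  set X := ∑ l ∈ s, f l * g l
  -- Cauchy–Schwarz for the vectors `(f, c)` and `(g, c)`; the cross term needs `2 X ≤ A + B`, which
  -- follows from `X² ≤ A B`.
  have hp : X + c ^ 2 ≤ √(A + c ^ 2) * √(B + c ^ 2) := by
    rw [← Real.sqrt_mul (by positivity)]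
    apply Real.le_sqrt_of_sq_le
    have h2 : 2 * X ≤ A + B := abs_le_of_sq_le_sq' (by nlinarith [sq_nonneg (A - B)])
      (by positivity) |>.2
    nlinarith [mul_le_mul_of_nonneg_right h2 (sq_nonneg c)]
  apply Real.sqrt_le_iff.2
  refine ⟨by positivity, ?_⟩
  have h1 := Real.sq_sqrt (show 0 ≤ A + c ^ 2 by positivity)
  have h2 := Real.sq_sqrt (show 0 ≤ B + c ^ 2 by positivity)
  have h3 := mul_le_mul_of_nonneg_left hp (show 0 ≤ 2 * (a * b) by positivity)
  have h4 : c ^ 2 = (a ^ 2 + b ^ 2 + 2 * (a * b)) * c ^ 2 := by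
    rw [show a ^ 2 + b ^ 2 + 2 * (a * b) = (a + b) ^ 2 by ring, hab]; ring
  calc _ ≤ a ^ 2 * A + b ^ 2 * B + 2 * (a * b) * X +
        (a ^ 2 + b ^ 2 + 2 * (a * b)) * c ^ 2 := by linarith
    _ = a ^ 2 * (A + c ^ 2) + b ^ 2 * (B + c ^ 2) + 2 * (a * b) * (X + c ^ 2) := by ring
    _ ≤ a ^ 2 * (A + c ^ 2) + b ^ 2 * (B + c ^ 2) +
        2 * (a * b) * (√(A + c ^ 2) * √(B + c ^ 2)) := by linarith
    _ = a ^ 2 * √(A + c ^ 2) ^ 2 + b ^ 2 * √(B + c ^ 2) ^ 2 +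
        2 * (a * b) * (√(A + c ^ 2) * √(B + c ^ 2)) := by rw [h1, h2]
    _ = _ := by ring

/-! ### Constraint functions, feasible sets, convexity and compactness. -/

namespace MulticastSystem

variable {M G : ℕ} {ι : Type*} (S : MulticastSystem M G ι)

/-- Root of the interference bound plus noise in `ζ`. -/
noncomputable def interference (i : ι) (w : Beamformer M G) : ℝ :=
  √((∑ l ∈ Finset.univ.erase (S.grp i),
      (‖inner ℂ (w l) (S.h i)‖ + S.eps i * ‖w l‖) ^ 2) + S.σ i ^ 2)

/-- The linear minorant at `u` of the gain `|w_gᴴ h|`. -/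
noncomputable def linGain (i : ι) (u w : Beamformer M G) : ℝ :=
  (inner ℂ (u (S.grp i)) (S.h i) * inner ℂ (S.h i) (w (S.grp i))).re /
    ‖inner ℂ (u (S.grp i)) (S.h i)‖

theorem zeta_eq (i : ι) (w : Beamformer M G) (t : ℝ) :
    S.zeta i w t = S.eps i * ‖w (S.grp i)‖ + √t * S.interference i w := rfl

theorem mem_feasibilitySet {P : PowerKind} {u w : Beamformer M G} {t : ℝ} :
    w ∈ S.feasibilitySet P u t ↔
      w ∈ S.powerSet P ∧ ∀ i, S.zeta i w t ≤ S.linGain i u w := by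
  simp [feasibilitySet, linGain]

theorem mem_appFeasible {P : PowerKind} {w : Beamformer M G} {t : ℝ} :
    (w, t) ∈ S.appFeasible P ↔
      0 ≤ t ∧ w ∈ S.powerSet P ∧ ∀ i, S.zeta i w t ≤ ‖inner ℂ (w (S.grp i)) (S.h i)‖ := by
  simp [appFeasible]

theorem eps_nonneg (i : ι) : 0 ≤ S.eps i := by unfold eps; positivity

theorem σ_le_interference (i : ι) (w : Beamformer M G) : S.σ i ≤ S.interference i w := by
  apply Real.le_sqrt_of_sq_le
  have : 0 ≤ ∑ l ∈ Finset.univ.erase (S.grp i),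
      (‖inner ℂ (w l) (S.h i)‖ + S.eps i * ‖w l‖) ^ 2 :=
    Finset.sum_nonneg fun _ _ => sq_nonneg _
  linarith

theorem continuous_zeta (i : ι) :
    Continuous fun p : Beamformer M G × ℝ => S.zeta i p.1 p.2 := by
  unfold zeta; fun_prop

/-- The noise keeps the factor of `√t` at least `σ`. This quantitative slack is what absorbs
perturbations of the gain in the stationarity proof. -/
theorem zeta_add_margin_le (i : ι) (w : Beamformer M G) {t t' : ℝ} (h : t ≤ t') :
    S.zeta i w t + S.σ i * (√t' - √t) ≤ S.zeta i w t' := by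
  rw [zeta_eq, zeta_eq]
  have := mul_le_mul_of_nonneg_left (S.σ_le_interference i w)
    (sub_nonneg.2 (Real.sqrt_le_sqrt h))
  nlinarith

theorem zeta_mono (i : ι) (w : Beamformer M G) {t t' : ℝ} (h : t ≤ t') :
    S.zeta i w t ≤ S.zeta i w t' := by
  have h1 := S.zeta_add_margin_le i w h
  have h2 := mul_nonneg (S.σ_pos i).le (sub_nonneg.2 (Real.sqrt_le_sqrt h))
  linarith

theorem sqrt_mul_σ_le_zeta (i : ι) (w : Beamformer M G) (t : ℝ) :
    √t * S.σ i ≤ S.zeta i w t := by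
  rw [zeta_eq]
  have h1 := mul_nonneg (S.eps_nonneg i) (norm_nonneg (w (S.grp i)))
  have h2 := mul_le_mul_of_nonneg_left (S.σ_le_interference i w) (Real.sqrt_nonneg t)
  linarith

/-- Bound the real part by the modulus. A vanishing denominator does no harm, the quotient being
`0`. -/
theorem linGain_le (i : ι) (u w : Beamformer M G) :
    S.linGain i u w ≤ ‖inner ℂ (w (S.grp i)) (S.h i)‖ := by
  unfold linGain
  refine div_le_of_le_mul₀ (norm_nonneg _) (norm_nonneg _) ?_
  refine (Complex.re_le_norm _).trans ?_
  rw [norm_mul, norm_inner_symm (S.h i), mul_comm]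

theorem linGain_self (i : ι) (w : Beamformer M G) :
    S.linGain i w w = ‖inner ℂ (w (S.grp i)) (S.h i)‖ := by
  unfold linGain
  have h := inner_mul_symm_re_eq_norm (𝕜 := ℂ) (w (S.grp i)) (S.h i)
  rw [norm_mul, norm_inner_symm (S.h i)] at h
  exact (congrArg (· / _) h).trans (mul_self_div_self _)

theorem continuous_linGain (i : ι) (u : Beamformer M G) : Continuous (S.linGain i u) := by
  unfold linGain
  have : Continuous fun w : Beamformer M G =>
    (inner ℂ (u (S.grp i)) (S.h i) * inner ℂ (S.h i) (w (S.grp i))).re := by fun_prop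
  exact this.div_const _

theorem feasibilitySet_anti {P : PowerKind} {u w : Beamformer M G} {t t' : ℝ} (h : t ≤ t')
    (hw : w ∈ S.feasibilitySet P u t') : w ∈ S.feasibilitySet P u t := by
  rw [mem_feasibilitySet] at *
  exact ⟨hw.1, fun i => (S.zeta_mono i w h).trans (hw.2 i)⟩

theorem appFeasible_of_mem_feasibilitySet {P : PowerKind} {u w : Beamformer M G} {t : ℝ}
    (ht : 0 ≤ t) (hw : w ∈ S.feasibilitySet P u t) : (w, t) ∈ S.appFeasible P := by
  rw [mem_feasibilitySet] at hw
  exact S.mem_appFeasible.2 ⟨ht, hw.1, fun i => (hw.2 i).trans (S.linGain_le i u w)⟩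

theorem mem_feasibilitySet_self {P : PowerKind} {w : Beamformer M G} {t : ℝ}
    (hw : (w, t) ∈ S.appFeasible P) : w ∈ S.feasibilitySet P w t := by
  rw [mem_appFeasible] at hw
  exact S.mem_feasibilitySet.2 ⟨hw.2.1, fun i => (hw.2.2 i).trans (S.linGain_self i w).ge⟩

theorem isClosed_powerSet (P : PowerKind) : IsClosed (S.powerSet P) := by
  cases P with
  | sumPower =>
    exact isClosed_le (by fun_prop) continuous_const
  | perAntenna =>
    simp only [powerSet, Set.ofPred_forall]
    exact isClosed_iInter fun m => isClosed_le (by fun_prop) continuous_const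

/-- The factor `M + 1` serves both power constraints: `1` suffices for the sum, `M` for the
antennas. -/
theorem norm_sq_le_of_mem_powerSet {P : PowerKind} {w : Beamformer M G}
    (hw : w ∈ S.powerSet P) (g : Fin G) : ‖w g‖ ^ 2 ≤ (M + 1) * S.γ := by
  have hγ := S.γ_pos
  cases P with
  | sumPower =>
    have h1 : ∑ g, ‖w g‖ ^ 2 ≤ S.γ := hw
    have h2 := Finset.single_le_sum (f := fun g => ‖w g‖ ^ 2) (fun _ _ => sq_nonneg _)
      (Finset.mem_univ g)
    have : 0 ≤ M * S.γ := by positivity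
    linarith
  | perAntenna =>
    have h1 : ∀ m : Fin M, ∑ g, ‖w g m‖ ^ 2 ≤ S.γ := hw
    rw [EuclideanSpace.norm_sq_eq]
    have : ∀ m ∈ Finset.univ, ‖w g m‖ ^ 2 ≤ S.γ := fun m _ =>
      (Finset.single_le_sum (f := fun g => ‖w g m‖ ^ 2) (fun _ _ => sq_nonneg _)
        (Finset.mem_univ g)).trans (h1 m)
    have h2 := Finset.sum_le_card_nsmul _ _ _ this
    simp at h2
    linarith

theorem norm_le_of_mem_powerSet {P : PowerKind} {w : Beamformer M G}
    (hw : w ∈ S.powerSet P) (g : Fin G) : ‖w g‖ ≤ √((M + 1) * S.γ) :=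
  Real.le_sqrt_of_sq_le (S.norm_sq_le_of_mem_powerSet hw g)

theorem isCompact_powerSet (P : PowerKind) : IsCompact (S.powerSet P) := by
  refine Metric.isCompact_of_isClosed_isBounded (S.isClosed_powerSet P) ?_
  refine (Metric.isBounded_closedBall (x := 0) (r := √((M + 1) * S.γ))).subset fun w hw => ?_
  rw [mem_closedBall_zero_iff, pi_norm_le_iff_of_nonneg (Real.sqrt_nonneg _)]
  exact S.norm_le_of_mem_powerSet hw

/-- An upper bound for the levels at which a beamformer can be feasible for user `i`. -/
noncomputable def levelBound (i : ι) : ℝ := (√((M + 1) * S.γ) * ‖S.h i‖ / S.σ i) ^ 2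

theorem level_le_of_appFeasible {P : PowerKind} {w : Beamformer M G} {t : ℝ}
    (hw : (w, t) ∈ S.appFeasible P) (i : ι) : t ≤ S.levelBound i := by
  rw [mem_appFeasible] at hw
  obtain ⟨ht, hP, h⟩ := hw
  have hσ := S.σ_pos i
  have h1 : √t * S.σ i ≤ √((M + 1) * S.γ) * ‖S.h i‖ :=
    (S.sqrt_mul_σ_le_zeta i w t).trans <| (h i).trans <| (norm_inner_le_norm _ _).trans <|
      mul_le_mul_of_nonneg_right (S.norm_le_of_mem_powerSet hP _) (norm_nonneg _)
  rw [← le_div_iff₀ hσ] at h1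
  calc t = √t ^ 2 := (Real.sq_sqrt ht).symm
    _ ≤ _ := pow_le_pow_left₀ (Real.sqrt_nonneg t) h1 2

theorem convex_powerSet (P : PowerKind) : Convex ℝ (S.powerSet P) := by
  intro x hx y hy a b ha hb hab
  have key : ∀ (p q r : Fin G → ℝ), (∑ g, p g ≤ S.γ) → (∑ g, q g ≤ S.γ) →
      (∀ g, r g ≤ a * p g + b * q g) → ∑ g, r g ≤ S.γ := by
    intro p q r hp hq hr
    calc ∑ g, r g ≤ ∑ g, (a * p g + b * q g) := Finset.sum_le_sum fun g _ => hr g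
      _ = a * ∑ g, p g + b * ∑ g, q g := by
        rw [Finset.sum_add_distrib, Finset.mul_sum, Finset.mul_sum]
      _ ≤ a * S.γ + b * S.γ := by gcongr
      _ = S.γ := by rw [← add_mul, hab, one_mul]
  cases P with
  | sumPower => exact key _ _ _ hx hy fun g => norm_combo_sq_le (x g) (y g) ha hb hab
  | perAntenna => exact fun m => key _ _ _ (hx m) (hy m) fun g =>
      norm_combo_sq_le (x g m) (y g m) ha hb hab

theorem linGain_combo (i : ι) (u x y : Beamformer M G) (a b : ℝ) :
    S.linGain i u (a • x + b • y) = a * S.linGain i u x + b * S.linGain i u y := by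
  unfold linGain
  simp only [Pi.add_apply, Pi.smul_apply, inner_add_right, mul_add, Complex.add_re,
    inner_smul_right_eq_smul, mul_smul_comm, Complex.smul_re, smul_eq_mul]
  ring

theorem zeta_combo_le (i : ι) (t : ℝ) (x y : Beamformer M G) {a b : ℝ}
    (ha : 0 ≤ a) (hb : 0 ≤ b) (hab : a + b = 1) :
    S.zeta i (a • x + b • y) t ≤ a * S.zeta i x t + b * S.zeta i y t := by
  have he := S.eps_nonneg i
  have h1 : ∀ l, ‖(a • x + b • y) l‖ ≤ a * ‖x l‖ + b * ‖y l‖ :=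
    fun l => norm_combo_le (x l) (y l) ha hb hab
  have h2 : ∀ l, ‖inner ℂ ((a • x + b • y) l) (S.h i)‖ ≤
      a * ‖inner ℂ (x l) (S.h i)‖ + b * ‖inner ℂ (y l) (S.h i)‖ := by
    intro l
    simp only [Pi.add_apply, Pi.smul_apply, inner_add_left, inner_smul_left_eq_smul]
    exact norm_combo_le _ _ ha hb hab
  have h3 : S.interference i (a • x + b • y) ≤
      a * S.interference i x + b * S.interference i y := by
    refine sqrt_sum_sq_add_const_combo_le _ _ _ _ _ ha hb hab
      (fun l => by positivity) (fun l => by positivity) (fun l => by positivity) fun l => ?_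
    have := mul_le_mul_of_nonneg_left (h1 l) he
    have := h2 l
    linarith
  simp only [zeta_eq]
  have h4 := mul_le_mul_of_nonneg_left (h1 (S.grp i)) he
  have h5 := mul_le_mul_of_nonneg_left h3 (Real.sqrt_nonneg t)
  linarith

theorem convex_feasibilitySet (P : PowerKind) (u : Beamformer M G) (t : ℝ) :
    Convex ℝ (S.feasibilitySet P u t) := by
  intro x hx y hy a b ha hb hab
  rw [mem_feasibilitySet] at *
  refine ⟨S.convex_powerSet P hx.1 hy.1 ha hb hab, fun i => ?_⟩
  rw [linGain_combo]
  refine (S.zeta_combo_le i t x y ha hb hab).trans ?_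
  have := mul_le_mul_of_nonneg_left (hx.2 i) ha
  have := mul_le_mul_of_nonneg_left (hy.2 i) hb
  linarith

theorem isClosed_appFeasible (P : PowerKind) : IsClosed (S.appFeasible P) := by
  have : S.appFeasible P = {p | 0 ≤ p.2} ∩ (Prod.fst ⁻¹' S.powerSet P ∩
      ⋂ i, {p | S.zeta i p.1 p.2 - ‖inner ℂ (p.1 (S.grp i)) (S.h i)‖ ≤ 0}) := by
    ext p; simp [appFeasible]
  rw [this]
  refine (isClosed_le continuous_const continuous_snd).inter
    (((S.isClosed_powerSet P).preimage continuous_fst).inter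
      (isClosed_iInter fun i => isClosed_le ?_ continuous_const))
  exact (S.continuous_zeta i).sub (by fun_prop)

/-- The level is maximized over pairs `(w, t)`, which form a compact set because levels are bounded
through any one user. -/
theorem exists_isSurrogateSolution [Nonempty ι] {P : PowerKind} {u w : Beamformer M G} {t : ℝ}
    (ht : 0 ≤ t) (hw : w ∈ S.feasibilitySet P u t) :
    ∃ (w' : Beamformer M G) (t' : ℝ), S.IsSurrogateSolution P u w' t' := by
  obtain ⟨i₀⟩ := ‹Nonempty ι›
  let K : Set (Beamformer M G × ℝ) := {p | 0 ≤ p.2 ∧ p.1 ∈ S.feasibilitySet P u p.2}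
  have hK : IsCompact K := by
    refine ((S.isCompact_powerSet P).prod (isCompact_Icc (a := 0)
      (b := S.levelBound i₀))).of_isClosed_subset ?_ ?_
    · have : K = {p | 0 ≤ p.2} ∩ (Prod.fst ⁻¹' S.powerSet P ∩
          ⋂ i, {p | S.zeta i p.1 p.2 ≤ S.linGain i u p.1}) := by
        ext p; simp [K, mem_feasibilitySet]
      rw [this]
      exact (isClosed_le continuous_const continuous_snd).inter
        (((S.isClosed_powerSet P).preimage continuous_fst).inter
          (isClosed_iInter fun i => isClosed_le (S.continuous_zeta i)
            ((S.continuous_linGain i u).comp continuous_fst)))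
    · rintro ⟨w, t⟩ ⟨h1, h2⟩
      exact ⟨h2.1, h1, S.level_le_of_appFeasible (S.appFeasible_of_mem_feasibilitySet h1 h2) i₀⟩
  obtain ⟨⟨w', t'⟩, hmem, hmax⟩ := hK.exists_isMaxOn ⟨(w, t), ht, hw⟩ continuous_snd.continuousOn
  exact ⟨w', t', hmem, fun w'' t'' h1 h2 => hmax (show (w'', t'') ∈ K from ⟨h1, h2⟩)⟩

end MulticastSystem

/-! ### Bisection and the inner loop. -/

theorem exists_bisectionStep {M G : ℕ} (A : ℝ → Set (Beamformer M G)) (s : BisectionState M G) :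
    ∃ s', BisectionStep A s s' := by
  by_cases h : (A ((s.tL + s.tU) / 2)).Nonempty
  · obtain ⟨w, hw⟩ := h
    exact ⟨⟨(s.tL + s.tU) / 2, s.tU, (s.tL + s.tU) / 2, w⟩, rfl, Or.inl ⟨hw, rfl, rfl⟩⟩
  · exact ⟨⟨s.tL, (s.tL + s.tU) / 2, (s.tL + s.tU) / 2, s.w⟩, rfl,
      Or.inr ⟨Set.not_nonempty_iff_eq_empty.1 h, rfl, rfl, rfl⟩⟩

theorem BisectionStep.width_eq {M G : ℕ} {A : ℝ → Set (Beamformer M G)}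
    {s s' : BisectionState M G} (h : BisectionStep A s s') :
    s'.tU - s'.tL = (s.tU - s.tL) / 2 := by
  obtain ⟨h1, ⟨-, h2, h3⟩ | ⟨-, -, h2, h3⟩⟩ := h <;> rw [h2, h3, h1] <;> ring

/-- The tested level becomes an endpoint of the new bracket. After an infeasible test it is the
upper one, so the output level need not be feasible for the output beamformer. -/
theorem BisectionStep.mem_Icc {M G : ℕ} {A : ℝ → Set (Beamformer M G)}
    {s s' : BisectionState M G} (h : BisectionStep A s s') (hs : s.tL ≤ s.tU) :
    s'.t ∈ Set.Icc s'.tL s'.tU := by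
  obtain ⟨h1, ⟨-, h2, h3⟩ | ⟨-, -, h2, h3⟩⟩ := h <;> rw [h2, h3, h1] <;>
    constructor <;> linarith

/-- The bracket contains the supremum of the feasible levels, and the current beamformer is
feasible at its lower end. -/
structure IsBisectionBracket {M G : ℕ} (A : ℝ → Set (Beamformer M G))
    (s : BisectionState M G) : Prop where
  nonneg : 0 ≤ s.tL
  le : s.tL ≤ s.tU
  mem : s.w ∈ A s.tL
  le_tU : ∀ t, 0 ≤ t → (A t).Nonempty → t ≤ s.tU

theorem IsBisectionBracket.step {M G : ℕ} {A : ℝ → Set (Beamformer M G)}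
    (hA : ∀ t t', t ≤ t' → A t' ⊆ A t) {s s' : BisectionState M G}
    (hs : IsBisectionBracket A s) (h : BisectionStep A s s') : IsBisectionBracket A s' := by
  obtain ⟨h0, hle, hm, hU⟩ := hs
  obtain ⟨h1, ⟨hw, h2, h3⟩ | ⟨he, hw, h2, h3⟩⟩ := h
  · refine ⟨?_, ?_, h2 ▸ hw, h3 ▸ hU⟩ <;> linarith
  · refine ⟨?_, ?_, hw ▸ h2 ▸ hm, fun t ht hne => ?_⟩
    · linarith
    · linarith
    -- Feasible sets shrink as the level rises, so an empty midpoint excludes every higher level.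
    · rw [h3]
      by_contra! hlt
      have := hne.mono (hA _ _ hlt.le)
      rw [he] at this
      exact Set.not_nonempty_empty this

namespace MulticastSystem

variable {M G : ℕ} {ι : Type*} (S : MulticastSystem M G ι)

theorem exists_innerLoopOutput [Nonempty ι] {P : PowerKind} {u : Beamformer M G} {t₀ ξ : ℝ}
    (hu : (u, t₀) ∈ S.appFeasible P) (hξ : 0 < ξ) :
    ∃ (w : Beamformer M G) (t : ℝ), S.InnerLoopOutput P ξ u w t := by
  obtain ⟨i₀⟩ := ‹Nonempty ι›
  choose next hnext using exists_bisectionStep (S.feasibilitySet P u)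
  have hb := S.level_le_of_appFeasible hu i₀
  -- The added `1` makes the initial bracket nondegenerate.
  let s₀ : BisectionState M G := ⟨t₀, S.levelBound i₀ + 1, t₀, u⟩
  let s : ℕ → BisectionState M G := fun j => next^[j] s₀
  have hstep : ∀ j, BisectionStep (S.feasibilitySet P u) (s j) (s (j + 1)) := fun j => by
    rw [show s (j + 1) = next (s j) from Function.iterate_succ_apply' _ _ _]
    exact hnext _
  have hwidth : ∀ j, (s j).tU - (s j).tL = ((s 0).tU - (s 0).tL) * (1 / 2) ^ j := by
    intro j
    induction j with
    | zero => simp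
    | succ j ih => rw [(hstep j).width_eq, ih, pow_succ]; ring
  have hex : ∃ j, 1 ≤ j ∧ (s j).tU - (s j).tL ≤ ξ := by
    have hlim : Tendsto (fun j => (s j).tU - (s j).tL) atTop (𝓝 0) := by
      refine Tendsto.congr (fun j => (hwidth j).symm) ?_
      simpa using (tendsto_pow_atTop_nhds_zero_of_lt_one (by norm_num : (0 : ℝ) ≤ 1 / 2)
        (by norm_num)).const_mul ((s 0).tU - (s 0).tL)
    obtain ⟨j, h1, h2⟩ := ((eventually_ge_atTop 1).and
      (hlim.eventually (eventually_le_nhds hξ))).exists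
    exact ⟨j, h1, h2⟩
  classical
  refine ⟨_, _, s, Nat.find hex, ⟨hu.1, ?_, rfl, S.mem_feasibilitySet_self hu, ?_⟩,
    fun j _ => hstep j, (Nat.find_spec hex).1, (Nat.find_spec hex).2, fun j h1 hj => ?_, rfl, rfl⟩
  · change t₀ < S.levelBound i₀ + 1
    linarith
  · rintro t' ht' ⟨w, hw⟩
    have := S.level_le_of_appFeasible (S.appFeasible_of_mem_feasibilitySet ht' hw) i₀
    change t' ≤ S.levelBound i₀ + 1
    linarith
  · by_contra! h
    exact Nat.find_min hex hj ⟨h1, h⟩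

theorem InnerLoopOutput.exists_level {P : PowerKind} {u w : Beamformer M G} {t ξ : ℝ}
    (h : S.InnerLoopOutput P ξ u w t) :
    ∃ tL tU : ℝ, 0 ≤ tL ∧ w ∈ S.feasibilitySet P u tL ∧ tU - tL ≤ ξ ∧ t ∈ Set.Icc tL tU ∧
      ∀ t', 0 ≤ t' → (S.feasibilitySet P u t').Nonempty → t' ≤ tU := by
  obtain ⟨s, J, ⟨h0, hlt, hw0, hu, hU⟩, hstep, hJ, hξ, -, rfl, rfl⟩ := h
  have hbr : ∀ j ≤ J, IsBisectionBracket (S.feasibilitySet P u) (s j) := by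
    intro j
    induction j with
    | zero => exact fun _ => ⟨h0, hlt.le, hw0.symm ▸ hu, hU⟩
    | succ j ih =>
      intro hj
      exact (ih (by omega)).step (fun _ _ hle _ => S.feasibilitySet_anti hle) (hstep j (by omega))
  -- At least one step was made, so the final `t` is a tested level rather than an arbitrary initial
  -- entry.
  obtain ⟨j, rfl⟩ : ∃ j, J = j + 1 := ⟨J - 1, by omega⟩
  have hl := hbr (j + 1) le_rfl
  exact ⟨_, _, hl.nonneg, hl.mem, hξ, (hstep j (by omega)).mem_Icc (hbr j (by omega)).le, hl.le_tU⟩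

/-- One outer iteration: the surrogate has a solution, its optimal value `T` is attained up to
`ξ`, and the new beamformer is feasible at some level `a` close to `T`. -/
theorem exists_level_of_outer_step [Nonempty ι] {P : PowerKind} {u w : Beamformer M G}
    {t ξ : ℝ} (hξ : 0 < ξ)
    (h : S.IsSurrogateSolution P u w t ∨ S.InnerLoopOutput P ξ u w t) :
    ∃ (w' : Beamformer M G) (T a : ℝ), S.IsSurrogateSolution P u w' T ∧ |t - T| ≤ ξ ∧
      (w, a) ∈ S.appFeasible P ∧ T - ξ ≤ a ∧ a ≤ T := by
  rcases h with h | h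
  · exact ⟨w, t, t, h, by simpa using hξ.le, S.appFeasible_of_mem_feasibilitySet h.1.1 h.1.2,
      by linarith, le_rfl⟩
  · obtain ⟨tL, tU, h0, hw, hle, ⟨hL, hU⟩, hmax⟩ := InnerLoopOutput.exists_level S h
    obtain ⟨w', T, hT⟩ := S.exists_isSurrogateSolution h0 hw
    have h1 := hT.2 w tL h0 hw
    have h2 := hmax T hT.1.1 ⟨w', hT.1.2⟩
    refine ⟨w', T, tL, hT, ?_, S.appFeasible_of_mem_feasibilitySet h0 hw, ?_, h1⟩
    · rw [abs_le]; constructor <;> linarith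
    · linarith

/-! ### Runs of the outer loop and their levels. -/

theorem exists_run [Nonempty ι] {P : PowerKind} {w₀ : Beamformer M G}
    (h₀ : ∃ t₀ : ℝ, (w₀, t₀) ∈ S.appFeasible P) {ξ : ℕ → ℝ} (hξ : ∀ k, 0 < ξ k) :
    ∃ (w : ℕ → Beamformer M G) (t : ℕ → ℝ), w 0 = w₀ ∧ S.IsAlgorithmRun P ξ w t ∧
      ∀ k, S.InnerLoopOutput P (ξ k) (w k) (w (k + 1)) (t (k + 1)) := by
  -- Feasibility at some level is carried in the subtype, so that the next inner loop can start.
  have hnext : ∀ (k : ℕ) (u : {u : Beamformer M G // ∃ t₀ : ℝ, (u, t₀) ∈ S.appFeasible P}),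
      ∃ v : {u : Beamformer M G // ∃ t₀ : ℝ, (u, t₀) ∈ S.appFeasible P},
        ∃ t : ℝ, S.InnerLoopOutput P (ξ k) u.1 v.1 t := by
    rintro k ⟨u, t₀, hu⟩
    obtain ⟨w, t, h⟩ := S.exists_innerLoopOutput hu (hξ k)
    obtain ⟨-, -, a, -, -, ha, -⟩ := S.exists_level_of_outer_step (hξ k) (Or.inr h)
    exact ⟨⟨w, a, ha⟩, t, h⟩
  choose next val hval using hnext
  let v : ℕ → {u : Beamformer M G // ∃ t₀ : ℝ, (u, t₀) ∈ S.appFeasible P} :=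
    fun k => Nat.rec ⟨w₀, h₀⟩ (fun k u => next k u) k
  have hall : ∀ k, S.InnerLoopOutput P (ξ k) (v k).1 (v (k + 1)).1 (val k (v k)) :=
    fun k => hval k (v k)
  -- The shift `k - 1` places the level beside its beamformer; `t 0` is arbitrary.
  exact ⟨fun k => (v k).1, fun k => val (k - 1) (v (k - 1)), rfl,
    ⟨h₀, fun k => Or.inr (hall k)⟩, hall⟩

/-- Along a run, every beamformer is feasible at a level `a k`; the surrogate optima `T k` and the
levels `a k` interlace up to the thresholds. -/
theorem IsAlgorithmRun.exists_levels [Nonempty ι] {P : PowerKind} {ξ : ℕ → ℝ}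
    {w : ℕ → Beamformer M G} {t : ℕ → ℝ} (hrun : S.IsAlgorithmRun P ξ w t)
    (hξ : ∀ k, 0 < ξ k) :
    ∃ (T a : ℕ → ℝ) (w' : ℕ → Beamformer M G),
      (∀ k, S.IsSurrogateSolution P (w k) (w' k) (T k) ∧ |t (k + 1) - T k| ≤ ξ k) ∧
      (∀ k, (w k, a k) ∈ S.appFeasible P) ∧ (∀ k, a k ≤ T k) ∧ ∀ k, T k - ξ k ≤ a (k + 1) := by
  obtain ⟨⟨t₀, h₀⟩, hstep⟩ := hrun
  -- One choice of `a k` must both be feasible and bound the preceding optimum.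
  have hfeas : ∀ k, ∃ a, (w k, a) ∈ S.appFeasible P ∧ ∀ j, k = j + 1 →
      ∃ (w' : Beamformer M G) (T : ℝ), S.IsSurrogateSolution P (w j) w' T ∧
        |t (j + 1) - T| ≤ ξ j ∧ T - ξ j ≤ a := by
    intro k
    cases k with
    | zero => exact ⟨t₀, h₀, fun j hj => by omega⟩
    | succ k =>
      obtain ⟨w', T, b, h1, h2, h3, h4, -⟩ := S.exists_level_of_outer_step (hξ k) (hstep k)
      refine ⟨b, h3, fun j hj => ?_⟩
      obtain rfl : k = j := by omega
      exact ⟨w', T, h1, h2, h4⟩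
  choose a ha hprev using hfeas
  choose w' T h1 h2 h3 using fun k => hprev (k + 1) k rfl
  exact ⟨T, a, w', fun k => ⟨h1 k, h2 k⟩, ha,
    fun k => (h1 k).2 _ _ (ha k).1 (S.mem_feasibilitySet_self (ha k)), h3⟩

end MulticastSystem

/-! ### Convergence of levels and stationarity of limit points. -/

/-- A sequence bounded above that decreases by at most summable amounts converges. -/
theorem exists_tendsto_of_le_add_summable {T ξ : ℕ → ℝ} (hξ : ∀ k, 0 ≤ ξ k) (hs : Summable ξ)
    {B : ℝ} (hB : ∀ k, T k ≤ B) (hT : ∀ k, T k - ξ k ≤ T (k + 1)) :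
    ∃ L, Tendsto T atTop (𝓝 L) := by
  -- Adding the partial sums of `ξ` restores monotonicity.
  have hmono : Monotone fun k => T k + ∑ j ∈ Finset.range k, ξ j := by
    refine monotone_nat_of_le_succ fun k => ?_
    rw [Finset.sum_range_succ]
    linarith [hT k]
  have hbdd : BddAbove (Set.range fun k => T k + ∑ j ∈ Finset.range k, ξ j) := by
    refine ⟨B + ∑' j, ξ j, ?_⟩
    rintro _ ⟨k, rfl⟩
    exact add_le_add (hB k) (hs.sum_le_tsum _ fun j _ => hξ j)
  have h := (tendsto_atTop_ciSup hmono hbdd).sub hs.hasSum.tendsto_sum_nat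
  exact ⟨_, h.congr fun k => by ring⟩

/-- The linearization of the modulus at `z₀` is exact up to second order. -/
theorem Complex.norm_sub_linearization_le {z₀ : ℂ} (z : ℂ) (hz : z₀ ≠ 0) :
    ‖z‖ - (z₀ * star z).re / ‖z₀‖ ≤ ‖z - z₀‖ ^ 2 / (2 * ‖z₀‖) := by
  have h0 : 0 < ‖z₀‖ := norm_pos_iff.2 hz
  have h1 : ‖z - z₀‖ ^ 2 = ‖z‖ ^ 2 - 2 * (z₀ * star z).re + ‖z₀‖ ^ 2 := by
    simp only [← Complex.normSq_eq_norm_sq, Complex.normSq_apply, Complex.mul_re,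
      Complex.sub_re, Complex.sub_im, Complex.star_def, Complex.conj_re, Complex.conj_im]
    ring
  rw [sub_le_iff_le_add, ← sub_le_iff_le_add', le_div_iff₀ h0] at *
  have : ‖z - z₀‖ ^ 2 / (2 * ‖z₀‖) * ‖z₀‖ = ‖z - z₀‖ ^ 2 / 2 := by field_simp
  -- `‖z₀‖` times the defect is half of `‖z - z₀‖² - (‖z‖ - ‖z₀‖)²`.
  nlinarith [sq_nonneg (‖z‖ - ‖z₀‖)]

namespace MulticastSystem

variable {M G : ℕ} {ι : Type*} (S : MulticastSystem M G ι)

theorem norm_sub_linGain_le (i : ι) {u : Beamformer M G} (w : Beamformer M G)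
    (hu : inner ℂ (u (S.grp i)) (S.h i) ≠ 0) :
    ‖inner ℂ (w (S.grp i)) (S.h i)‖ - S.linGain i u w ≤
      ‖inner ℂ (w (S.grp i)) (S.h i) - inner ℂ (u (S.grp i)) (S.h i)‖ ^ 2 /
        (2 * ‖inner ℂ (u (S.grp i)) (S.h i)‖) := by
  have := Complex.norm_sub_linearization_le (inner ℂ (w (S.grp i)) (S.h i)) hu
  rwa [Complex.star_def, inner_conj_symm] at this

theorem tendsto_linGain (i : ι) {u : ℕ → Beamformer M G} {v : Beamformer M G}
    (hu : Tendsto u atTop (𝓝 v)) (hv : inner ℂ (v (S.grp i)) (S.h i) ≠ 0)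
    (w : Beamformer M G) :
    Tendsto (fun j => S.linGain i (u j) w) atTop (𝓝 (S.linGain i v w)) := by
  have hc : ContinuousAt (fun u : Beamformer M G => S.linGain i u w) v := by
    unfold linGain
    refine ContinuousAt.div ?_ ?_ (norm_ne_zero_iff.2 hv)
    · exact (Continuous.continuousAt (by fun_prop))
    · exact (Continuous.continuousAt (by fun_prop))
  exact hc.tendsto.comp hu

/-- A positive limit of surrogate optima is the optimal value of the surrogate at the limit. -/
theorem level_le_of_tendsto [Finite ι] {P : PowerKind} {u : ℕ → Beamformer M G} {T : ℕ → ℝ}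
    {v w : Beamformer M G} {b t : ℝ} (hu : Tendsto u atTop (𝓝 v)) (hT : Tendsto T atTop (𝓝 b))
    (hopt : ∀ j t', 0 ≤ t' → (S.feasibilitySet P (u j) t').Nonempty → t' ≤ T j)
    (hb : 0 ≤ b) (hv : ∀ i, inner ℂ (v (S.grp i)) (S.h i) ≠ 0)
    (hw : w ∈ S.feasibilitySet P v t) : t ≤ b := by
  by_contra! hlt
  rw [mem_feasibilitySet] at hw
  -- At the midpoint level `w` has strict slack at `v`, which survives replacing `v` by `u j`.
  have hs : √((b + t) / 2) < √t := Real.sqrt_lt_sqrt (by linarith) (by linarith)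
  have hev : ∀ᶠ j in atTop, ∀ i, S.zeta i w ((b + t) / 2) ≤ S.linGain i (u j) w := by
    rw [eventually_all]
    intro i
    have hlt : S.zeta i w ((b + t) / 2) < S.linGain i v w := by
      have h1 := S.zeta_add_margin_le i w (show (b + t) / 2 ≤ t by linarith)
      have h2 := mul_pos (S.σ_pos i) (sub_pos.2 hs)
      linarith [hw.2 i]
    exact (S.tendsto_linGain i hu (hv i) w).eventually (eventually_ge_nhds hlt)
  have hle : (b + t) / 2 ≤ b := ge_of_tendsto hT <| hev.mono fun j hj =>
    hopt j _ (by linarith) ⟨w, S.mem_feasibilitySet.2 ⟨hw.1, hj⟩⟩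
  linarith

/-- If the gain of some user vanishes to first order at the limit, the level cannot grow linearly. -/
theorem eventually_not_zeta_le {i : ι} {v d : Beamformer M G} {τ : ℕ → ℝ}
    {y : ℕ → Beamformer M G} (hτ : ∀ n, 0 < τ n) (hτ0 : Tendsto τ atTop (𝓝 0))
    (hy : Tendsto y atTop (𝓝 d))
    (hi : ‖inner ℂ (v (S.grp i)) (S.h i)‖ ≤ S.eps i * ‖v (S.grp i)‖) {ε : ℝ} (hε : 0 < ε) :
    ∀ᶠ n in atTop, ¬ S.zeta i (v + τ n • y n) (τ n * ε) ≤
      ‖inner ℂ ((v + τ n • y n) (S.grp i)) (S.h i)‖ := by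
  have hσ := S.σ_pos i
  -- Feasibility would give `√(τ ε) σ ≤ τ K`, hence `ε σ² ≤ τ K²`, whose right side tends to `0`.
  let K : ℕ → ℝ := fun n => ‖inner ℂ (y n (S.grp i)) (S.h i)‖ + S.eps i * ‖y n (S.grp i)‖
  have hK : Tendsto K atTop (𝓝 (‖inner ℂ (d (S.grp i)) (S.h i)‖ + S.eps i * ‖d (S.grp i)‖)) := by
    have hc : Continuous fun d : Beamformer M G =>
      ‖inner ℂ (d (S.grp i)) (S.h i)‖ + S.eps i * ‖d (S.grp i)‖ := by fun_prop
    exact (hc.tendsto d).comp hy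
  have hlim : Tendsto (fun n => τ n * K n ^ 2) atTop (𝓝 0) := by
    simpa using hτ0.mul (hK.pow 2)
  filter_upwards [hlim.eventually (eventually_lt_nhds (show 0 < ε * S.σ i ^ 2 by positivity))]
    with n hn hz
  have hτn := hτ n
  have he := S.eps_nonneg i
  have h1 : ‖inner ℂ ((v + τ n • y n) (S.grp i)) (S.h i)‖ ≤
      ‖inner ℂ (v (S.grp i)) (S.h i)‖ + τ n * ‖inner ℂ (y n (S.grp i)) (S.h i)‖ := by
    simp only [Pi.add_apply, Pi.smul_apply, inner_add_left, inner_smul_left_eq_smul]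
    refine (norm_add_le _ _).trans_eq ?_
    rw [norm_smul, Real.norm_of_nonneg hτn.le]
  have h2 : ‖v (S.grp i)‖ - τ n * ‖y n (S.grp i)‖ ≤ ‖(v + τ n • y n) (S.grp i)‖ := by
    have := norm_sub_le_norm_add (v (S.grp i)) (τ n • y n (S.grp i))
    rwa [norm_smul, Real.norm_of_nonneg hτn.le] at this
  have h3 := mul_le_mul_of_nonneg_left h2 he
  have h4 := mul_le_mul_of_nonneg_left (S.σ_le_interference i (v + τ n • y n))
    (Real.sqrt_nonneg (τ n * ε))
  rw [zeta_eq] at hz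
  have h5 : √(τ n * ε) * S.σ i ≤ τ n * K n := by
    simp only [K]
    nlinarith
  have h6 := pow_le_pow_left₀ (by positivity) h5 2
  rw [mul_pow, Real.sq_sqrt (by positivity)] at h6
  nlinarith

/-- If all users have a positive margin at the limit, the surrogate optima stay away from `0`. -/
theorem pos_of_tendsto_of_margin [Finite ι] {P : PowerKind} {u : ℕ → Beamformer M G}
    {T : ℕ → ℝ} {v : Beamformer M G} {b : ℝ} (hu : Tendsto u atTop (𝓝 v))
    (hT : Tendsto T atTop (𝓝 b)) (huP : ∀ j, u j ∈ S.powerSet P)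
    (hopt : ∀ j t', 0 ≤ t' → (S.feasibilitySet P (u j) t').Nonempty → t' ≤ T j)
    (hv : ∀ i, S.eps i * ‖v (S.grp i)‖ < ‖inner ℂ (v (S.grp i)) (S.h i)‖) : 0 < b := by
  have hcont : ∀ i, Continuous fun p : Beamformer M G × ℝ =>
      S.zeta i p.1 p.2 - ‖inner ℂ (p.1 (S.grp i)) (S.h i)‖ := fun i =>
    (S.continuous_zeta i).sub (by fun_prop)
  have hδ : ∀ᶠ δ in 𝓝[>] (0 : ℝ), ∀ i,
      S.zeta i v δ - ‖inner ℂ (v (S.grp i)) (S.h i)‖ < 0 := by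
    rw [eventually_all]
    intro i
    have hc : Continuous fun δ : ℝ => S.zeta i v δ - ‖inner ℂ (v (S.grp i)) (S.h i)‖ := by
      unfold zeta; fun_prop
    have h0 : S.zeta i v 0 - ‖inner ℂ (v (S.grp i)) (S.h i)‖ < 0 := by
      simpa [zeta_eq] using hv i
    exact ((hc.tendsto 0).eventually (eventually_lt_nhds h0)).filter_mono nhdsWithin_le_nhds
  obtain ⟨δ, hδ, hpos⟩ := (hδ.and self_mem_nhdsWithin).exists
  refine lt_of_lt_of_le (show 0 < δ from hpos) (ge_of_tendsto hT ?_)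
  have hev : ∀ᶠ j in atTop, ∀ i,
      S.zeta i (u j) δ - ‖inner ℂ (u j (S.grp i)) (S.h i)‖ < 0 := by
    rw [eventually_all]
    intro i
    have hlim : Tendsto (fun j => (u j, δ)) atTop (𝓝 (v, δ)) :=
      hu.prodMk_nhds tendsto_const_nhds
    exact hlim.eventually (((hcont i).tendsto (v, δ)).eventually (eventually_lt_nhds (hδ i)))
  filter_upwards [hev] with j hj
  exact hopt j δ (le_of_lt hpos) ⟨u j, S.mem_feasibilitySet_self <|
    S.mem_appFeasible.2 ⟨le_of_lt hpos, huP j, fun i => by linarith [hj i]⟩⟩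

/-- Along a tangent sequence with linearly growing level, points feasible for the approximate
problem are feasible for the surrogate at half the growth rate. -/
theorem eventually_zeta_half_le_linGain {i : ι} {v d : Beamformer M G} {b : ℝ} (hb : 0 < b)
    {τ : ℕ → ℝ} {y : ℕ → Beamformer M G} (hτ : ∀ n, 0 < τ n) (hτ0 : Tendsto τ atTop (𝓝 0))
    (hy : Tendsto y atTop (𝓝 d)) (hv : inner ℂ (v (S.grp i)) (S.h i) ≠ 0)
    {ε : ℝ} (hε : 0 < ε) :
    ∀ᶠ n in atTop, S.zeta i (v + τ n • y n) (b + τ n * ε) ≤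
      ‖inner ℂ ((v + τ n • y n) (S.grp i)) (S.h i)‖ →
      S.zeta i (v + τ n • y n) (b + τ n * (ε / 2)) ≤ S.linGain i v (v + τ n • y n) := by
  have hσ := S.σ_pos i
  -- After division by `τ`, the linearization error tends to `0`, whereas the margin from lowering
  -- the level (`hM`) has a positive limit.
  have hK : Tendsto (fun n => τ n * (‖inner ℂ (y n (S.grp i)) (S.h i)‖ ^ 2 /
      (2 * ‖inner ℂ (v (S.grp i)) (S.h i)‖))) atTop (𝓝 0) := by
    have hc : Continuous fun d : Beamformer M G => ‖inner ℂ (d (S.grp i)) (S.h i)‖ ^ 2 /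
      (2 * ‖inner ℂ (v (S.grp i)) (S.h i)‖) := Continuous.div_const (by fun_prop) _
    simpa using hτ0.mul ((hc.tendsto d).comp hy)
  have hM : Tendsto (fun n => S.σ i * ((ε / 2) / (2 * √(b + τ n * ε)))) atTop
      (𝓝 (S.σ i * ((ε / 2) / (2 * √(b + 0 * ε))))) := by
    refine Tendsto.const_mul _ (Tendsto.div tendsto_const_nhds ?_ ?_)
    · exact ((((hτ0.mul_const ε).const_add b).sqrt).const_mul 2)
    · have : 0 < √(b + 0 * ε) := Real.sqrt_pos.2 (by linarith)
      positivity
  have hpos : 0 < S.σ i * ((ε / 2) / (2 * √(b + 0 * ε))) := by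
    have : 0 < √(b + 0 * ε) := Real.sqrt_pos.2 (by linarith)
    positivity
  filter_upwards [hK.eventually_lt hM hpos] with n hn hz
  have hτn := hτ n
  have hlin := S.norm_sub_linGain_le i (v + τ n • y n) hv
  have hdiff : inner ℂ ((v + τ n • y n) (S.grp i)) (S.h i) - inner ℂ (v (S.grp i)) (S.h i) =
      τ n • inner ℂ (y n (S.grp i)) (S.h i) := by
    simp only [Pi.add_apply, Pi.smul_apply, inner_add_left, inner_smul_left_eq_smul,
      add_sub_cancel_left]
  rw [hdiff, norm_smul, Real.norm_of_nonneg hτn.le, mul_pow] at hlin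
  have hmargin := S.zeta_add_margin_le i (v + τ n • y n)
    (show b + τ n * (ε / 2) ≤ b + τ n * ε by nlinarith)
  -- Tangent bound for the concave root, taken at the larger argument.
  have hsq : τ n * ((ε / 2) / (2 * √(b + τ n * ε))) ≤
      √(b + τ n * ε) - √(b + τ n * (ε / 2)) := by
    have hp : 0 < √(b + τ n * ε) := Real.sqrt_pos.2 (by positivity)
    have h1 := Real.sq_sqrt (show 0 ≤ b + τ n * ε by positivity)
    have h2 := Real.sq_sqrt (show 0 ≤ b + τ n * (ε / 2) by positivity)
    rw [← mul_div_assoc, div_le_iff₀ (by positivity)]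
    nlinarith [sq_nonneg (√(b + τ n * ε) - √(b + τ n * (ε / 2)))]
  have h1 := mul_le_mul_of_nonneg_left hsq hσ.le
  have h2 := mul_lt_mul_of_pos_left hn hτn
  have h3 : τ n ^ 2 * ‖inner ℂ (y n (S.grp i)) (S.h i)‖ ^ 2 /
      (2 * ‖inner ℂ (v (S.grp i)) (S.h i)‖) = τ n * (τ n * (‖inner ℂ (y n (S.grp i)) (S.h i)‖ ^ 2 /
      (2 * ‖inner ℂ (v (S.grp i)) (S.h i)‖))) := by ring
  rw [h3] at hlin
  have h4 : τ n * (S.σ i * ((ε / 2) / (2 * √(b + τ n * ε)))) =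
    S.σ i * (τ n * ((ε / 2) / (2 * √(b + τ n * ε)))) := by ring
  rw [h4] at h2
  linarith

/-- Limits of iterates whose feasible levels and surrogate optima have a common limit are
stationary. -/
theorem isStationaryPoint_of_tendsto [Finite ι] {P : PowerKind} {u : ℕ → Beamformer M G}
    {a T : ℕ → ℝ} {v : Beamformer M G} {b : ℝ} (hu : Tendsto u atTop (𝓝 v))
    (ha : Tendsto a atTop (𝓝 b)) (hT : Tendsto T atTop (𝓝 b))
    (hfeas : ∀ j, (u j, a j) ∈ S.appFeasible P)
    (hopt : ∀ j t', 0 ≤ t' → (S.feasibilitySet P (u j) t').Nonempty → t' ≤ T j) :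
    IsStationaryPoint (S.appFeasible P) Prod.snd (v, b) := by
  have hvb : (v, b) ∈ S.appFeasible P :=
    (S.isClosed_appFeasible P).mem_of_tendsto (hu.prodMk_nhds ha) (.of_forall hfeas)
  refine ⟨hvb, ?_⟩
  rintro d τ y hτ hτ0 hy hX ε hε
  obtain ⟨hb, -, hvz⟩ := S.mem_appFeasible.1 hvb
  have hy1 : Tendsto (fun n => (y n).1) atTop (𝓝 d.1) := (continuous_fst.tendsto d).comp hy
  have hXn : ∀ n, ε < (y n).2 → v + τ n • (y n).1 ∈ S.powerSet P ∧
      ∀ i, S.zeta i (v + τ n • (y n).1) (b + τ n * ε) ≤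
        ‖inner ℂ ((v + τ n • (y n).1) (S.grp i)) (S.h i)‖ := by
    intro n hn
    obtain ⟨-, h1, h2⟩ := S.mem_appFeasible.1 (hX n)
    refine ⟨h1, fun i => (S.zeta_mono i _ ?_).trans (h2 i)⟩
    have := mul_le_mul_of_nonneg_left hn.le (hτ n).le
    simpa using this
  -- The difference quotient of the objective is exactly `(y n).2`.
  suffices ∀ᶠ n in atTop, (y n).2 ≤ ε by
    filter_upwards [this] with n hn
    have hτn := (hτ n).ne'
    have : (((v, b) + τ n • y n : Beamformer M G × ℝ).2 - b) / τ n = (y n).2 := by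
      simp only [Prod.snd_add, Prod.smul_snd, smul_eq_mul]
      field_simp
      ring
    exact this.trans_le hn
  rcases hb.eq_or_lt with rfl | hb
  · have : ∃ i, ‖inner ℂ (v (S.grp i)) (S.h i)‖ ≤ S.eps i * ‖v (S.grp i)‖ := by
      by_contra! hv
      exact (S.pos_of_tendsto_of_margin hu hT (fun j => (hfeas j).2.1) hopt hv).false
    obtain ⟨i, hi⟩ := this
    filter_upwards [S.eventually_not_zeta_le hτ hτ0 hy1 hi hε] with n hn
    by_contra! hlt
    have := (hXn n hlt).2 i
    rw [zero_add] at this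
    exact hn this
  · have hv : ∀ i, inner ℂ (v (S.grp i)) (S.h i) ≠ 0 := by
      intro i h0
      have h1 := (S.sqrt_mul_σ_le_zeta i v b).trans (hvz i)
      rw [h0, norm_zero] at h1
      exact absurd (mul_pos (Real.sqrt_pos.2 hb) (S.σ_pos i)) h1.not_gt
    have hev := eventually_all.2 fun i =>
      S.eventually_zeta_half_le_linGain hb hτ hτ0 hy1 (hv i) hε
    filter_upwards [hev] with n hn
    by_contra! hlt
    obtain ⟨h1, h2⟩ := hXn n hlt
    have h3 : v + τ n • (y n).1 ∈ S.feasibilitySet P v (b + τ n * (ε / 2)) :=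
      S.mem_feasibilitySet.2 ⟨h1, fun i => hn i (h2 i)⟩
    have h4 := S.level_le_of_tendsto hu hT hopt hb.le hv h3
    have := mul_pos (hτ n) (half_pos hε)
    linarith

end MulticastSystem

/-- If all limit points of a sequence in a compact set lie in a set, together with the limit of a
second sequence, then the distance to that set tends to zero. -/
theorem tendsto_infDist_of_mapClusterPt {X Y : Type*} [PseudoMetricSpace X] [PseudoMetricSpace Y]
    {K : Set X} (hK : IsCompact K) {u : ℕ → X} (hu : ∀ k, u k ∈ K) {t : ℕ → Y} {b : Y}
    (ht : Tendsto t atTop (𝓝 b)) {Z : Set (X × Y)}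
    (hZ : ∀ x, MapClusterPt x atTop u → (x, b) ∈ Z) :
    Tendsto (fun k => Metric.infDist (u k, t k) Z) atTop (𝓝 0) := by
  refine tendsto_of_subseq_tendsto fun ns hns => ?_
  obtain ⟨x, -, φ, hφ, hlim⟩ := hK.tendsto_subseq fun n => hu (ns n)
  have hsub : Tendsto (fun n => ns (φ n)) atTop atTop := hns.comp hφ.tendsto_atTop
  have hx : (x, b) ∈ Z := hZ x (MapClusterPt.of_comp hsub hlim.mapClusterPt)
  have hpair : Tendsto (fun n => (u (ns (φ n)), t (ns (φ n)))) atTop (𝓝 (x, b)) :=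
    Tendsto.prodMk_nhds hlim (ht.comp hsub)
  exact ⟨φ, squeeze_zero (fun _ => Metric.infDist_nonneg)
    (fun _ => Metric.infDist_le_dist_of_mem hx) (tendsto_iff_dist_tendsto_zero.1 hpair)⟩

/-! ### Single group with spherical error sets. -/

namespace MulticastSystem

variable {M G : ℕ} {ι : Type*} (S : MulticastSystem M G ι)

theorem lambdaMin_of_scalar (hM : 1 ≤ M) {i : ι} {c : ℝ}
    (hC : S.C i = (c : ℂ) • (1 : Matrix (Fin M) (Fin M) ℂ)) : S.lambdaMin i = c := by
  have : Nonempty (Fin M) := ⟨⟨0, hM⟩⟩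
  have hev : ∀ m, (S.C_posDef i).isHermitian.eigenvalues m = c := by
    intro m
    have h1 := (S.C_posDef i).isHermitian.mulVec_eigenvectorBasis m
    have h2 : ∀ v : Fin M → ℂ, (S.C i).mulVec v = (c : ℂ) • v := fun v => by
      rw [hC, Matrix.smul_mulVec, Matrix.one_mulVec]
    rw [h2, ← Complex.coe_smul, ← sub_eq_zero, ← sub_smul] at h1
    rcases smul_eq_zero.1 h1 with h | h
    · exact_mod_cast (sub_eq_zero.1 h).symm
    · exact absurd (WithLp.ofLp_injective 2 h)
        ((S.C_posDef i).isHermitian.eigenvectorBasis.orthonormal.ne_zero m)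
  simp [lambdaMin, hev]

theorem eps_of_scalar (hM : 1 ≤ M) {i : ι} {μ : ℝ} (hμ : 0 < μ)
    (hC : S.C i = ((1 / μ ^ 2 : ℝ) : ℂ) • (1 : Matrix (Fin M) (Fin M) ℂ)) : S.eps i = μ := by
  rw [eps, S.lambdaMin_of_scalar hM hC, Real.sqrt_div zero_le_one, Real.sqrt_sq hμ.le,
    Real.sqrt_one, one_div_one_div]

theorem mem_errorSet_of_scalar {i : ι} {μ : ℝ} (hμ : 0 < μ)
    (hC : S.C i = ((1 / μ ^ 2 : ℝ) : ℂ) • (1 : Matrix (Fin M) (Fin M) ℂ))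
    {e : EuclideanSpace ℂ (Fin M)} : e ∈ S.errorSet i ↔ ‖e‖ ≤ μ := by
  have h : dotProduct (star e.ofLp) e.ofLp = ((‖e‖ ^ 2 : ℝ) : ℂ) := by
    rw [dotProduct_comm, ← EuclideanSpace.inner_eq_star_dotProduct, inner_self_eq_norm_sq_to_K]
    push_cast
    rfl
  rw [errorSet, Set.mem_ofPred_eq, hC, Matrix.smul_mulVec, Matrix.one_mulVec, dotProduct_smul, h,
    smul_eq_mul, ← Complex.ofReal_mul, Complex.ofReal_re, one_div, inv_mul_le_iff₀ (by positivity),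
    mul_one]
  exact pow_le_pow_iff_left₀ (norm_nonneg e) hμ.le two_ne_zero

theorem SINR_nonneg (i : ι) (w : Beamformer M G) (e : EuclideanSpace ℂ (Fin M)) :
    0 ≤ S.SINR i w e := by
  refine div_nonneg (sq_nonneg _) (add_nonneg (Finset.sum_nonneg fun _ _ => sq_nonneg _)
    (sq_nonneg _))

theorem worstSINR_le [Finite ι] (w : Beamformer M G) {i : ι} {e : EuclideanSpace ℂ (Fin M)}
    (he : e ∈ S.errorSet i) : S.worstSINR w ≤ S.SINR i w e := by
  refine (ciInf_le (Set.finite_range _).bddBelow i).trans ?_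
  refine ciInf_le (f := fun e : S.errorSet i => S.SINR i w e) ⟨0, ?_⟩ ⟨e, he⟩
  rintro _ ⟨e, rfl⟩
  exact S.SINR_nonneg i w e

theorem zero_mem_errorSet (i : ι) : (0 : EuclideanSpace ℂ (Fin M)) ∈ S.errorSet i := by
  simp [errorSet]

section SingleGroup

variable {S} [Subsingleton (Fin G)] (hM : 1 ≤ M) {μ : ℝ} (hμ : 0 < μ)
  (hC : ∀ i, S.C i = ((1 / μ ^ 2 : ℝ) : ℂ) • (1 : Matrix (Fin M) (Fin M) ℂ))

theorem SINR_of_subsingleton (i : ι) (w : Beamformer M G) (e : EuclideanSpace ℂ (Fin M)) :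
    S.SINR i w e = ‖inner ℂ (w (S.grp i)) (S.h i + e)‖ ^ 2 / S.σ i ^ 2 := by
  have : (Finset.univ.erase (S.grp i)) = ∅ :=
    Finset.eq_empty_of_forall_notMem fun l hl => Finset.ne_of_mem_erase hl (Subsingleton.elim _ _)
  rw [SINR, this, Finset.sum_empty, zero_add]

include hM hμ hC

theorem zeta_of_subsingleton (i : ι) (w : Beamformer M G) (t : ℝ) :
    S.zeta i w t = μ * ‖w (S.grp i)‖ + √t * S.σ i := by
  have : (Finset.univ.erase (S.grp i)) = ∅ :=
    Finset.eq_empty_of_forall_notMem fun l hl => Finset.ne_of_mem_erase hl (Subsingleton.elim _ _)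
  rw [zeta, this, Finset.sum_empty, zero_add, Real.sqrt_sq (S.σ_pos i).le,
    S.eps_of_scalar hM hμ (hC i)]

/-- By Cauchy–Schwarz an admissible error lowers the gain by at most `μ ‖w_g‖`. -/
theorem le_worstSINR_of_appFeasible [Nonempty ι] {P : PowerKind} {w : Beamformer M G} {t : ℝ}
    (hw : (w, t) ∈ S.appFeasible P) : t ≤ S.worstSINR w := by
  obtain ⟨ht, -, h⟩ := S.mem_appFeasible.1 hw
  refine le_ciInf fun i => ?_
  have : Nonempty (S.errorSet i) := ⟨⟨0, S.zero_mem_errorSet i⟩⟩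
  refine le_ciInf fun e => ?_
  have hσ := S.σ_pos i
  have he : ‖(e : EuclideanSpace ℂ (Fin M))‖ ≤ μ := (S.mem_errorSet_of_scalar hμ (hC i)).1 e.2
  have h1 := h i
  rw [zeta_of_subsingleton hM hμ hC] at h1
  have h2 : ‖inner ℂ (w (S.grp i)) (S.h i)‖ - ‖inner ℂ (w (S.grp i)) (e : EuclideanSpace ℂ (Fin M))‖
      ≤ ‖inner ℂ (w (S.grp i)) (S.h i + e)‖ := by
    rw [inner_add_right]
    exact norm_sub_le_norm_add _ _
  have h3 : ‖inner ℂ (w (S.grp i)) (e : EuclideanSpace ℂ (Fin M))‖ ≤ ‖w (S.grp i)‖ * μ :=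
    (norm_inner_le_norm _ _).trans (mul_le_mul_of_nonneg_left he (norm_nonneg _))
  rw [SINR_of_subsingleton, le_div_iff₀ (by positivity)]
  calc t * S.σ i ^ 2 = (√t * S.σ i) ^ 2 := by rw [mul_pow, Real.sq_sqrt ht]
    _ ≤ _ := pow_le_pow_left₀ (by positivity) (by linarith) 2

/-- Errors along the beamformer attain the Cauchy–Schwarz bound. Positivity of `t` matters: `0 ≤
worstSINR w` holds always, but level `0` still demands gain at least `μ ‖w_g‖`. -/
theorem appFeasible_of_le_worstSINR [Finite ι] {P : PowerKind} {w : Beamformer M G} {t : ℝ}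
    (hw : w ∈ S.powerSet P) (ht : 0 < t) (h : t ≤ S.worstSINR w) : (w, t) ∈ S.appFeasible P := by
  refine S.mem_appFeasible.2 ⟨ht.le, hw, fun i => ?_⟩
  have hσ := S.σ_pos i
  rw [zeta_of_subsingleton hM hμ hC]
  set x := w (S.grp i) with hx
  set z : ℂ := inner ℂ x (S.h i) with hz
  have key : ∀ c : ℂ, ‖c‖ * ‖x‖ ≤ μ → √t * S.σ i ≤ ‖z + c * (‖x‖ : ℂ) ^ 2‖ := by
    intro c hc
    have he : c • x ∈ S.errorSet i := by
      rw [S.mem_errorSet_of_scalar hμ (hC i), norm_smul]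
      exact hc
    have h1 := h.trans (S.worstSINR_le w he)
    have h2 : inner ℂ x (c • x) = c * (‖x‖ : ℂ) ^ 2 := by
      rw [inner_smul_right, inner_self_eq_norm_sq_to_K]
      rfl
    rw [SINR_of_subsingleton, ← hx, inner_add_right, ← hz, h2, le_div_iff₀ (by positivity)] at h1
    refine (pow_le_pow_iff_left₀ (by positivity) (norm_nonneg _) two_ne_zero).1 ?_
    rwa [mul_pow, Real.sq_sqrt ht.le]
  have hpos : 0 < √t * S.σ i := mul_pos (Real.sqrt_pos.2 ht) hσ
  have hz0 : 0 < ‖z‖ := by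
    have := key 0 (by simpa using hμ.le)
    simp only [zero_mul, add_zero] at this
    linarith
  have hx0 : 0 < ‖x‖ := by
    rw [norm_pos_iff]
    rintro h0
    rw [hz, h0, inner_zero_left, norm_zero] at hz0
    exact hz0.false
  have hxC : (‖x‖ : ℂ) ≠ 0 := by exact_mod_cast hx0.ne'
  have hzC : (‖z‖ : ℂ) ≠ 0 := by exact_mod_cast hz0.ne'
  rcases le_or_gt ‖z‖ (μ * ‖x‖) with hle | hlt
  -- An admissible error cancels the signal, contradicting `t > 0`.
  · have := key (-z / (‖x‖ : ℂ) ^ 2) (by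
      rw [norm_div, norm_neg, norm_pow, Complex.norm_real, norm_norm]
      rw [div_mul_eq_mul_div, div_le_iff₀ (by positivity)]
      nlinarith)
    rw [div_mul_cancel₀ _ (pow_ne_zero 2 hxC), add_neg_cancel, norm_zero] at this
    linarith
  -- An error of norm `μ`, opposite in phase to `z`, reduces the gain to `‖z‖ - μ ‖x‖`.
  · have := key (-((μ / (‖x‖ * ‖z‖) : ℝ) : ℂ) * z) (by
      rw [norm_mul, norm_neg, Complex.norm_real, Real.norm_of_nonneg (by positivity)]
      exact le_of_eq (by field_simp))
    have h3 : z + -((μ / (‖x‖ * ‖z‖) : ℝ) : ℂ) * z * (‖x‖ : ℂ) ^ 2 =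
        ((1 - μ * ‖x‖ / ‖z‖ : ℝ) : ℂ) * z := by
      push_cast
      field_simp
      ring
    rw [h3, norm_mul, Complex.norm_real, Real.norm_of_nonneg, sub_mul, one_mul,
      div_mul_cancel₀ _ hz0.ne'] at this
    · linarith
    · rw [sub_nonneg, div_le_one hz0]
      exact hlt.le

theorem worstSINR_eq_of_isStationaryPoint [Finite ι] [Nonempty ι] {P : PowerKind}
    {w : Beamformer M G} {t : ℝ}
    (h : IsStationaryPoint (S.appFeasible P) Prod.snd (w, t)) : S.worstSINR w = t := by
  refine le_antisymm ?_ (le_worstSINR_of_appFeasible hM hμ hC h.1)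
  by_contra! hlt
  obtain ⟨ht, hP, -⟩ := S.mem_appFeasible.1 h.1
  obtain ⟨-, -, hf⟩ := S.mem_appFeasible.1
    (appFeasible_of_le_worstSINR hM hμ hC hP (ht.trans_lt hlt) le_rfl)
  have hd : 0 < S.worstSINR w - t := sub_pos.2 hlt
  have hτ : ∀ n : ℕ, 0 < (S.worstSINR w - t) * (1 / ((n : ℝ) + 1)) := fun n => by positivity
  have hτ0 : Tendsto (fun n : ℕ => (S.worstSINR w - t) * (1 / ((n : ℝ) + 1))) atTop (𝓝 0) := by
    simpa using (tendsto_one_div_add_atTop_nhds_zero_nat (𝕜 := ℝ)).const_mul (S.worstSINR w - t)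
  -- If `t` were below the worst SINR, it could be raised with `w` fixed, at slope `1`.
  have hev := h.2 (0, 1) _ (fun _ => (0, 1)) hτ hτ0 tendsto_const_nhds (fun n => ?_) (1 / 2)
    (by norm_num)
  · obtain ⟨n, hn⟩ := hev.exists
    have hτn := (hτ n).ne'
    simp only [Prod.snd_add, Prod.smul_snd, smul_eq_mul, mul_one, add_sub_cancel_left] at hn
    rw [div_self hτn] at hn
    norm_num at hn
  · have h1 : 1 / ((n : ℝ) + 1) ≤ 1 := by
      rw [div_le_one (by positivity)]
      linarith [Nat.cast_nonneg (α := ℝ) n]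
    have h2 := mul_le_mul_of_nonneg_left h1 hd.le
    have h3 := hτ n
    rw [show (w, t) + ((S.worstSINR w - t) * (1 / ((n : ℝ) + 1))) • ((0, 1) : Beamformer M G × ℝ) =
      (w, t + (S.worstSINR w - t) * (1 / ((n : ℝ) + 1))) by ext <;> simp]
    exact S.mem_appFeasible.2 ⟨by linarith, hP,
      fun i => (S.zeta_mono i w (by linarith)).trans (hf i)⟩

/-- A tangent sequence with quotients above `ε` lifts, with level slope `ε`, to the feasible set of
the approximate problem. Passing to a subsequence makes every lifted point feasible, as the
definition requires. -/
theorem isStationaryPoint_worstSINR [Finite ι] [Nonempty ι] {P : PowerKind}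
    {w : Beamformer M G} {t : ℝ} (h : IsStationaryPoint (S.appFeasible P) Prod.snd (w, t)) :
    IsStationaryPoint (S.powerSet P) S.worstSINR w := by
  have hval := worstSINR_eq_of_isStationaryPoint hM hμ hC h
  obtain ⟨ht, hP, -⟩ := S.mem_appFeasible.1 h.1
  refine ⟨hP, fun d τ y hτ hτ0 hy hX ε hε => ?_⟩
  by_contra hcon
  obtain ⟨φ, hφ, hbad⟩ := extraction_of_frequently_atTop (not_eventually.1 hcon)
  have hev := h.2 (d, ε) (τ ∘ φ) (fun n => (y (φ n), ε)) (fun n => hτ _)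
    (hτ0.comp hφ.tendsto_atTop)
    ((hy.comp hφ.tendsto_atTop).prodMk_nhds tendsto_const_nhds) (fun n => ?_) (ε / 2)
    (half_pos hε)
  · obtain ⟨n, hn⟩ := hev.exists
    have hτn := (hτ (φ n)).ne'
    simp only [Prod.snd_add, Prod.smul_snd, smul_eq_mul, add_sub_cancel_left,
      Function.comp_apply] at hn
    rw [mul_div_cancel_left₀ _ hτn] at hn
    linarith
  · have h1 := hbad n
    have hτn := hτ (φ n)
    rw [not_le, lt_div_iff₀ hτn, hval] at h1
    have h2 : t + τ (φ n) * ε ≤ S.worstSINR (w + τ (φ n) • y (φ n)) := by linarith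
    exact appFeasible_of_le_worstSINR hM hμ hC (hX (φ n))
      (add_pos_of_nonneg_of_pos ht (mul_pos hτn hε)) h2

end SingleGroup

end MulticastSystem

/-! ### The convergence theorem. -/

theorem theorem2 {M G : ℕ} {ι : Type*} [Fintype ι] [Nonempty ι] (hM : 1 ≤ M)
    (S : MulticastSystem M G ι) (P : PowerKind) :
    -- from every feasible initial point the algorithm can be run
    (∀ w₀ : Beamformer M G, (∃ t₀ : ℝ, (w₀, t₀) ∈ S.appFeasible P) →
      ∀ ξ : ℕ → ℝ, (∀ k, 0 < ξ k) →
        ∃ (w : ℕ → Beamformer M G) (t : ℕ → ℝ), w 0 = w₀ ∧ S.IsAlgorithmRun P ξ w t ∧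
          ∀ k, S.InnerLoopOutput P (ξ k) (w k) (w (k + 1)) (t (k + 1))) ∧
    -- and every run converges
    ∀ (ξ : ℕ → ℝ) (w : ℕ → Beamformer M G) (t : ℕ → ℝ),
      (∀ k, 0 < ξ k) → Summable ξ → S.IsAlgorithmRun P ξ w t →
      -- inner loop: convex feasibility problems; the surrogate is solved up to the threshold
      (∀ (k : ℕ) (t' : ℝ), 0 ≤ t' → Convex ℝ (S.feasibilitySet P (w k) t')) ∧
      (∀ k : ℕ, ∃ (w' : Beamformer M G) (t' : ℝ), S.IsSurrogateSolution P (w k) w' t' ∧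
        |t (k + 1) - t'| ≤ ξ k) ∧
      -- outer loop
      ∃ tstar : ℝ, Tendsto t atTop (𝓝 tstar) ∧
        (∃ wstar : Beamformer M G, MapClusterPt wstar atTop w) ∧
        (∀ wstar : Beamformer M G, MapClusterPt wstar atTop w →
          IsStationaryPoint (S.appFeasible P) Prod.snd (wstar, tstar) ∧
          (G = 1 → ∀ μ : ℝ, 0 < μ →
            (∀ i, S.C i = ((1 / μ ^ 2 : ℝ) : ℂ) • (1 : Matrix (Fin M) (Fin M) ℂ)) →
            IsStationaryPoint (S.powerSet P) S.worstSINR wstar ∧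
              S.worstSINR wstar = tstar)) ∧
        Tendsto (fun k => Metric.infDist (w k, t k)
          {p | IsStationaryPoint (S.appFeasible P) Prod.snd p}) atTop (𝓝 0) := by
  refine ⟨fun w₀ h₀ ξ hξ => S.exists_run h₀ hξ, fun ξ w t hξ hsum hrun => ?_⟩
  obtain ⟨T, a, w', hsurr, hfeas, haT, hTa⟩ := hrun.exists_levels S hξ
  obtain ⟨i₀⟩ := ‹Nonempty ι›
  have hTB : ∀ k, T k ≤ S.levelBound i₀ := fun k => S.level_le_of_appFeasible
    (S.appFeasible_of_mem_feasibilitySet (hsurr k).1.1.1 (hsurr k).1.1.2) i₀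
  obtain ⟨b, hT⟩ := exists_tendsto_of_le_add_summable (fun k => (hξ k).le) hsum hTB
    fun k => (hTa k).trans (haT (k + 1))
  have hξ0 := hsum.tendsto_atTop_zero
  -- `a (k + 1)` is squeezed between `T k - ξ k` and `T (k + 1)`.
  have ha : Tendsto a atTop (𝓝 b) := by
    rw [← tendsto_add_atTop_iff_nat 1]
    exact tendsto_of_tendsto_of_tendsto_of_le_of_le (by simpa using hT.sub hξ0)
      ((tendsto_add_atTop_iff_nat 1).2 hT) hTa fun k => haT (k + 1)
  have ht : Tendsto t atTop (𝓝 b) := by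
    rw [← tendsto_add_atTop_iff_nat 1]
    have h0 : Tendsto (fun k => t (k + 1) - T k) atTop (𝓝 0) :=
      squeeze_zero_norm (fun k => (hsurr k).2) hξ0
    simpa using h0.add hT
  have hW : ∀ k, w k ∈ S.powerSet P := fun k => (hfeas k).2.1
  have hstat : ∀ v, MapClusterPt v atTop w →
      IsStationaryPoint (S.appFeasible P) Prod.snd (v, b) := by
    intro v hv
    obtain ⟨φ, hφ, hlim⟩ := hv.tendsto_subseq
    exact S.isStationaryPoint_of_tendsto hlim (ha.comp hφ.tendsto_atTop)
      (hT.comp hφ.tendsto_atTop) (fun j => hfeas (φ j))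
      fun j t' h0 ⟨x, hx⟩ => (hsurr (φ j)).1.2 x t' h0 hx
  refine ⟨fun k t' _ => S.convex_feasibilitySet P (w k) t',
    fun k => ⟨w' k, T k, hsurr k⟩, b, ht, ?_, fun v hv => ⟨hstat v hv, ?_⟩,
    tendsto_infDist_of_mapClusterPt (S.isCompact_powerSet P) hW ht hstat⟩
  · obtain ⟨v, -, φ, hφ, hlim⟩ := (S.isCompact_powerSet P).tendsto_subseq hW
    exact ⟨v, MapClusterPt.of_comp hφ.tendsto_atTop hlim.mapClusterPt⟩
  · rintro rfl μ hμ hC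
    exact ⟨MulticastSystem.isStationaryPoint_worstSINR hM hμ hC (hstat v hv),
      MulticastSystem.worstSINR_eq_of_isStationaryPoint hM hμ hC (hstat v hv)⟩
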